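/- For subsets $X, Y \subseteq \mathbb{R}^d$ let $$c(X)=\sup_{y\in\mathbb{R}^d}\inf_{x\in X}\|x-y\|$$ be the covering radius of $X$, let $$d_B(X,Y)=\inf_{f\colon X\to Y \text{ bijection}}\ \sup_{x\in X}\|x-f(x)\|$$ (equal to $\infty$ if no bijection exists) be the bottleneck distance, and let $$d_{EB}(X,Y)=\inf_{\psi\in \mathrm{Iso}(\mathbb{R}^d)} d_B(X,\psi(Y))$$ be the Euclidean bottleneck distance, where $\mathrm{Iso}(\mathbb{R}^d)$ is the group of all isometries of $\mathbb{R}^d$. A lattice in $\mathbb{R}^d$ is a subgroup $\Lambda=\mathbb{Z}v_1+\dots+\mathbb{Z}v_d$ generated by a basis $v_1,\dots,v_d$ of $\mathbb{R}^d$; its density is $1/|\det(v_1,\dots,v_d)|$. For every dimension $d$, every density $\kappa$ and every $R\ge 0$, the family of all lattices in $\mathbb{R}^d$ of density $\kappa$ with covering radius at most $R$ is bounded with respect to $d_{EB}$, that is, its diameter $$\sup\{\, d_{EB}(\Lambda,\Lambda') : \Lambda,\Lambda' \text{ lattices in } \mathbb{R}^d \text{ of density } \kappa,\ c(\Lambda)\le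 R,\ c(\Lambda')\le R \,\}$$ is finite. -/

import Mathlib

open scoped NNReal ENNReal

namespace LatticeSpace

/-- The covering radius `sup_y inf_{x ∈ X} ‖x - y‖` of a subset of `ℝᵈ`, with values in `[0, ∞]`. -/
noncomputable def coveringRadius {d : ℕ} (X : Set (EuclideanSpace ℝ (Fin d))) : ℝ≥0∞ :=
  ⨆ y : EuclideanSpace ℝ (Fin d), ⨅ x ∈ X, edist x y

/-- The bottleneck distance: the infimum over all bijections `f : X → Y` of
`sup_{x ∈ X} ‖x - f x‖`; it is `∞` if there is no bijection. -/
noncomputable def bottleneckDist {d : ℕ} (X Y : Set (EuclideanSpace ℝ (Fin d))) : ℝ≥0∞ :=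
  ⨅ f : X ≃ Y, ⨆ x : X,
    edist (x : EuclideanSpace ℝ (Fin d)) (f x : EuclideanSpace ℝ (Fin d))

/-- The Euclidean bottleneck distance: the infimum of `bottleneckDist X (ψ Y)` over all
isometries `ψ` of `ℝᵈ`. -/
noncomputable def euclideanBottleneckDist {d : ℕ}
    (X Y : Set (EuclideanSpace ℝ (Fin d))) : ℝ≥0∞ :=
  ⨅ ψ : EuclideanSpace ℝ (Fin d) ≃ᵢ EuclideanSpace ℝ (Fin d), bottleneckDist X (ψ '' Y)

/-- The diameter of a family of subsets of `ℝᵈ` in the Euclidean bottleneck distance. -/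
noncomputable def euclideanBottleneckDiam {d : ℕ}
    (A : Set (Set (EuclideanSpace ℝ (Fin d)))) : ℝ≥0∞ :=
  ⨆ X ∈ A, ⨆ Y ∈ A, euclideanBottleneckDist X Y

/-- A family of subsets of `ℝᵈ` is bounded in the Euclidean bottleneck distance if its
diameter is finite. -/
def IsEuclideanBottleneckBounded {d : ℕ} (A : Set (Set (EuclideanSpace ℝ (Fin d)))) : Prop :=
  euclideanBottleneckDiam A < ∞

/-- `L` is a (full-rank) lattice: a discrete additive subgroup which spans `ℝᵈ`. -/
def IsLattice {d : ℕ} (L : Submodule ℤ (EuclideanSpace ℝ (Fin d))) : Prop :=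
  ∃ _ : DiscreteTopology L, IsZLattice ℝ L

/-- The density of a lattice: the inverse of the volume of its unit cell. -/
noncomputable def density {d : ℕ} (L : Submodule ℤ (EuclideanSpace ℝ (Fin d))) : ℝ :=
  1 / ZLattice.covolume L

/-- The family of the lattices of `ℝᵈ`, as point sets, whose density is `κ` and whose covering
radius is at most `R`. -/
def latticesOfDensityCovering (d : ℕ) (κ : ℝ) (R : ℝ≥0) :
    Set (Set (EuclideanSpace ℝ (Fin d))) :=
  {X | ∃ L : Submodule ℤ (EuclideanSpace ℝ (Fin d)),
    X = (L : Set (EuclideanSpace ℝ (Fin d))) ∧ IsLattice L ∧ density L = κ ∧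
      coveringRadius X ≤ R}

end LatticeSpace

/-! No isometry is needed: the identity already gives the bound `2 * (R + 1)`. Spread each lattice
point's mass, one covolume, over a ball so that the whole lattice has density `1`. The mass of a
finite set of points of `L` is then dominated by that of its neighbours in `M`; as covolumes agree,
this is Hall's condition (`exists_injective_dist_le`). Injections both ways combine by
Schröder–Bernstein (`exists_equiv_dist_le`). -/

namespace LatticeSpace

open MeasureTheory

section Lattice

variable {E : Type*} [NormedAddCommGroup E] [NormedSpace ℝ E] [FiniteDimensional ℝ E]

/-- A lattice has only finitely many points in each closed ball. -/
theorem finite_setOf_dist_le (L : Submodule ℤ E) [DiscreteTopology L] (p : E) (r : ℝ) :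
    {l : L | dist p l ≤ r}.Finite := by
  have : ProperSpace E := FiniteDimensional.proper ℝ E
  have hclosed : IsClosed (L : Set E) :=
    AddSubgroup.isClosed_of_discrete (H := L.toAddSubgroup)
  have h : (Metric.closedBall p r ∩ (L : Set E)).Finite :=
    Metric.finite_isBounded_inter_isClosed DiscreteTopology.isDiscrete
      Metric.isBounded_closedBall hclosed
  refine (h.preimage (f := ((↑) : L → E)) Subtype.val_injective.injOn).subset fun l hl => ?_
  exact ⟨by simpa [dist_comm] using hl, l.2⟩

variable [MeasurableSpace E] [BorelSpace E]

/-- If the closed balls of radius `r` around the points of a lattice cover the space, there is a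
measurable function supported in the closed ball of radius `r` around the origin whose
translates by the lattice sum up to `1`. -/
theorem exists_tsum_translate_eq_one (L : Submodule ℤ E) [DiscreteTopology L] [IsZLattice ℝ L]
    {r : ℝ} (hr : ∀ p : E, ∃ l : L, dist p l ≤ r) :
    ∃ φ : E → ℝ≥0∞, Measurable φ ∧ (∀ p, φ p ≠ 0 → ‖p‖ ≤ r) ∧
      ∀ p, ∑' l : L, φ (p - l) = 1 := by
  let χ : E → ℝ≥0∞ := (Metric.closedBall (0 : E) r).indicator 1
  have hχ : Measurable χ := measurable_one.indicator measurableSet_closedBall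
  -- `N p` counts the lattice points within `r` of `p`. It is `L`-periodic, nonzero and finite, so
  -- `χ / N` is the required function.
  let N : E → ℝ≥0∞ := fun p => ∑' l : L, χ (p - l)
  have hN : Measurable N := Measurable.tsum fun l => hχ.comp (measurable_id.sub_const (l : E))
  have hN_sub (p : E) (l : L) : N (p - l) = N p := by
    simp only [N, sub_sub]
    exact (Equiv.addLeft l).tsum_eq fun k : L => χ (p - k)
  have hχ_one (p : E) (l : L) (h : dist p l ≤ r) : χ (p - l) = 1 := by
    simp [χ, ← dist_eq_norm, h]
  have hχ_zero (p : E) (l : L) (h : ¬ dist p l ≤ r) : χ (p - l) = 0 := by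
    simp only [χ, Set.indicator_apply_eq_zero, mem_closedBall_zero_iff, ← dist_eq_norm]
    exact fun h' => absurd h' h
  have hN_zero (p : E) : N p ≠ 0 := by
    obtain ⟨l, hl⟩ := hr p
    refine fun h => one_ne_zero (α := ℝ≥0∞) ?_
    rw [← hχ_one p l hl]
    exact ENNReal.tsum_eq_zero.1 h l
  have hN_top (p : E) : N p ≠ ∞ := by
    have hfin := finite_setOf_dist_le L p r
    have hsum : N p = ∑ l ∈ hfin.toFinset, χ (p - l) :=
      tsum_eq_sum fun l hl => hχ_zero p l (by simpa using hl)
    rw [hsum]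
    refine ENNReal.sum_ne_top.2 fun l hl => ?_
    rw [hχ_one p l (by simpa using hl)]
    exact ENNReal.one_ne_top
  refine ⟨fun p => χ p * (N p)⁻¹, hχ.mul hN.inv, fun p hp => ?_, fun p => ?_⟩
  · simpa using Set.mem_of_indicator_ne_zero (left_ne_zero_of_mul hp)
  · simp only [hN_sub, ENNReal.tsum_mul_right]
    exact ENNReal.mul_inv_cancel (hN_zero p) (hN_top p)

/-- A function whose translates by a lattice sum up to `1` has the covolume as its integral. -/
theorem lintegral_eq_covolume (L : Submodule ℤ E) [DiscreteTopology L] [IsZLattice ℝ L]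
    (μ : Measure E) [μ.IsAddHaarMeasure] {φ : E → ℝ≥0∞} (hφ : Measurable φ)
    (hsum : ∀ p, ∑' l : L, φ (p - l) = 1) :
    ∫⁻ p, φ p ∂μ = ENNReal.ofReal (ZLattice.covolume L μ) := by
  have : MeasurableVAdd L E := (inferInstance : MeasurableVAdd L.toAddSubgroup E)
  have : VAddInvariantMeasure L E μ := (inferInstance : VAddInvariantMeasure L.toAddSubgroup E μ)
  let b := Module.Free.chooseBasis ℤ L
  have hD := ZLattice.isAddFundamentalDomain b μ
  have hD_top : μ (ZSpan.fundamentalDomain (b.ofZLatticeBasis ℝ L)) ≠ ∞ :=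
    (ZSpan.fundamentalDomain_isBounded _).measure_lt_top.ne
  rw [ZLattice.covolume_eq_measure_fundamentalDomain L μ hD, ofReal_measureReal hD_top,
    hD.lintegral_eq_tsum', ← lintegral_tsum]
  · have h (p : E) : ∑' l : L, φ (-l +ᵥ p) = 1 := by
      rw [← hsum p]
      exact tsum_congr fun l => congrArg φ (neg_add_eq_sub (l : E) p)
    simp [h]
  · exact fun l => (hφ.comp (measurable_const_vadd (-l))).aemeasurable

/-- A lattice injects into any lattice of the same covolume by a map which moves each point by at
most the sum of the covering radii (by the marriage theorem, counting by volume). -/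
theorem exists_injective_dist_le (L M : Submodule ℤ E) [DiscreteTopology L] [IsZLattice ℝ L]
    [DiscreteTopology M] [IsZLattice ℝ M] (μ : Measure E) [μ.IsAddHaarMeasure]
    (hcov : ZLattice.covolume L μ = ZLattice.covolume M μ) {r s : ℝ}
    (hr : ∀ p : E, ∃ l : L, dist p l ≤ r) (hs : ∀ p : E, ∃ m : M, dist p m ≤ s) :
    ∃ f : L → M, Function.Injective f ∧ ∀ l : L, dist (l : E) (f l) ≤ r + s := by
  classical
  obtain ⟨φ, hφ, hφ_supp, hφ_sum⟩ := exists_tsum_translate_eq_one L hr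
  obtain ⟨ψ, hψ, hψ_supp, hψ_sum⟩ := exists_tsum_translate_eq_one M hs
  let t (l : L) : Finset M := (finite_setOf_dist_le M (l : E) (r + s)).toFinset
  have ht (l : L) (m : M) : m ∈ t l ↔ dist (l : E) m ≤ r + s := by simp [t]
  suffices h : ∀ S : Finset L, S.card ≤ (S.biUnion t).card by
    obtain ⟨f, hf, hft⟩ := (Finset.all_card_le_biUnion_card_iff_exists_injective t).1 h
    exact ⟨f, hf, fun l => (ht l (f l)).1 (hft l)⟩
  intro S
  -- If some `l ∈ S` contributes at `p`, every `m` contributing at `p` is within `r + s` of `l`, so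
  -- the right side is the full sum `1`.
  have hle (p : E) : ∑ l ∈ S, φ (p - l) ≤ ∑ m ∈ S.biUnion t, ψ (p - m) := by
    by_cases h : ∀ l ∈ S, φ (p - l) = 0
    · rw [Finset.sum_eq_zero h]
      exact zero_le
    · push Not at h
      obtain ⟨l, hl, hl0⟩ := h
      calc ∑ l ∈ S, φ (p - l) ≤ ∑' l : L, φ (p - l) := ENNReal.sum_le_tsum S
        _ = ∑' m : M, ψ (p - m) := by rw [hφ_sum, hψ_sum]
        _ = ∑ m ∈ S.biUnion t, ψ (p - m) := tsum_eq_sum fun m hm => by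
          by_contra hm0
          refine hm (Finset.mem_biUnion.2 ⟨l, hl, (ht l m).2 ?_⟩)
          have h₁ := hφ_supp _ hl0
          have h₂ := hψ_supp _ hm0
          rw [← dist_eq_norm] at h₁ h₂
          exact (dist_triangle_left _ _ p).trans (add_le_add h₁ h₂)
  have hint (K : Submodule ℤ E) (θ : E → ℝ≥0∞) (hθ : Measurable θ) (T : Finset K) :
      ∫⁻ p, ∑ k ∈ T, θ (p - k) ∂μ = T.card * ∫⁻ p, θ p ∂μ := by
    have hmeas (k : K) : Measurable fun p : E => θ (p - k) :=
      hθ.comp (measurable_id.sub_const (k : E))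
    rw [lintegral_finsetSum T fun k _ => hmeas k]
    simp [lintegral_sub_right_eq_self]
  have h := lintegral_mono (μ := μ) hle
  rw [hint L φ hφ, hint M ψ hψ, lintegral_eq_covolume L μ hφ hφ_sum,
    lintegral_eq_covolume M μ hψ hψ_sum, ← hcov,
    ENNReal.mul_le_mul_iff_left (by simpa using ZLattice.covolume_pos L μ)
      ENNReal.ofReal_ne_top] at h
  exact_mod_cast h

/-- The points of two lattices of the same covolume are in a bijection which moves each point by
at most the sum of radii for which the balls around the points of the lattices cover the space. -/
theorem exists_equiv_dist_le (L M : Submodule ℤ E) [DiscreteTopology L] [IsZLattice ℝ L]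
    [DiscreteTopology M] [IsZLattice ℝ M] (μ : Measure E) [μ.IsAddHaarMeasure]
    (hcov : ZLattice.covolume L μ = ZLattice.covolume M μ) {r s : ℝ}
    (hr : ∀ p : E, ∃ l : L, dist p l ≤ r) (hs : ∀ p : E, ∃ m : M, dist p m ≤ s) :
    ∃ f : L ≃ M, ∀ l : L, dist (l : E) (f l) ≤ r + s := by
  obtain ⟨f, hf, hf_le⟩ := exists_injective_dist_le L M μ hcov hr hs
  obtain ⟨g, hg, hg_le⟩ := exists_injective_dist_le M L μ hcov.symm hs hr
  -- The bijection pairs points only along `f` or `g`, so the distance bound survives.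
  obtain ⟨h, hh, hh_le⟩ := Function.Embedding.schroeder_bernstein_of_rel hf hg
    (fun l m => dist (l : E) m ≤ r + s) hf_le
    fun m => by rw [dist_comm, add_comm]; exact hg_le m
  exact ⟨Equiv.ofBijective h hh, hh_le⟩

end Lattice

variable {d : ℕ}

/-- For general `X` the infimum need not be attained; the slack `1` makes the inequality strict and
yields a point. -/
theorem exists_dist_le_of_coveringRadius_le {X : Set (EuclideanSpace ℝ (Fin d))} {R : ℝ≥0}
    (h : coveringRadius X ≤ R) (p : EuclideanSpace ℝ (Fin d)) :
    ∃ x : X, dist p x ≤ R + 1 := by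
  have hlt : ⨅ x ∈ X, edist x p < ((R + 1 : ℝ≥0) : ℝ≥0∞) :=
    ((le_iSup (fun y => ⨅ x ∈ X, edist x y) p).trans h).trans_lt (by
      exact_mod_cast lt_add_one R)
  obtain ⟨x, hx⟩ := iInf_lt_iff.1 hlt
  obtain ⟨hxX, hx⟩ := iInf_lt_iff.1 hx
  refine ⟨⟨x, hxX⟩, ?_⟩
  rw [edist_nndist, ENNReal.coe_lt_coe] at hx
  rw [dist_comm]
  exact_mod_cast hx.le

theorem euclideanBottleneckDist_le_bottleneckDist (X Y : Set (EuclideanSpace ℝ (Fin d))) :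
    euclideanBottleneckDist X Y ≤ bottleneckDist X Y :=
  (iInf_le _ (IsometryEquiv.refl _)).trans_eq (congrArg (bottleneckDist X) (Set.image_id Y))

theorem bottleneckDist_le_of_equiv {X Y : Set (EuclideanSpace ℝ (Fin d))} (f : X ≃ Y) {r : ℝ}
    (hf : ∀ x : X, dist (x : EuclideanSpace ℝ (Fin d)) (f x) ≤ r) :
    bottleneckDist X Y ≤ ENNReal.ofReal r :=
  (iInf_le _ f).trans <| iSup_le fun x => by
    rw [edist_dist]
    exact ENNReal.ofReal_le_ofReal (hf x)

end LatticeSpace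

theorem mainTheorem6 (d : ℕ) (κ : ℝ) (R : ℝ≥0) :
    LatticeSpace.IsEuclideanBottleneckBounded
      (LatticeSpace.latticesOfDensityCovering d κ R) := by
  refine lt_of_le_of_lt (b := ENNReal.ofReal ((R + 1) + (R + 1))) ?_ ENNReal.ofReal_lt_top
  refine iSup₂_le fun X hX => iSup₂_le fun Y hY => ?_
  obtain ⟨L, rfl, ⟨_, _⟩, hLκ, hLR⟩ := hX
  obtain ⟨M, rfl, ⟨_, _⟩, hMκ, hMR⟩ := hY
  have hcov : ZLattice.covolume L = ZLattice.covolume M := by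
    simpa [LatticeSpace.density] using hLκ.trans hMκ.symm
  obtain ⟨f, hf⟩ := LatticeSpace.exists_equiv_dist_le L M MeasureTheory.volume hcov
    (LatticeSpace.exists_dist_le_of_coveringRadius_le hLR)
    (LatticeSpace.exists_dist_le_of_coveringRadius_le hMR)
  exact (LatticeSpace.euclideanBottleneckDist_le_bottleneckDist _ _).trans
    (LatticeSpace.bottleneckDist_le_of_equiv f hf)
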